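/- Consider the $K$-armed bandit problem with bandit feedback: in round $t=1,\dots,T$ a loss vector $\ell_t\in[0,1]^K$ is drawn, the agent plays an arm $A_t\in[K]$ (possibly at random, independently of $\ell_t$ given the past), and it observes only $\ell_{t,A_t}$. The environment is a stochastic bandit with adaptively timed switches: there are (discrete) laws $Q_0,Q_1,\dots$ on $[0,1]^K$ with $Q_s\neq Q_{s+1}$ for all $s$, and $\ell_t$ is drawn from $Q_{x_t}$, freshly given the past, where $x_t$ is the number of switches up to round $t$. Here $x_1=0$, $x_{t+1}\in\{x_t,x_t+1\}$, and $x_{t+1}$ is chosen by the adversary as a function of all observations $(x_s,A_s,\ell_{s,A_s})_{s\le t}$. The agent is told $x_t$ before it plays in round $t$ (an uninformed agent is one that ignores this information). For $S\ge 0$ let $\Pi_S$ be the set of sequences $\pi\in[K]^T$ with $\sum_{t=1}^{T-1}\mathbb 1\{\pi_t\ne\pi_{t+1}\}\le S$, and define the $S$-switch pseudo-regret $$\mathrm{Reg}_{SW}(T,S)=\max_{\pi\in\Pi_S}\mathbb E\Big[\sum_{t=1}^T\big(\ell_{t,A_t}-\ell_{t,\pi_t}\big)\Big].$$ **Theorem.**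 For all constants $a,c>0$ there is a constant $c'>0$, depending only on $a$ and $c$, such that for every $K\ge 3$ there is $T_0$ (depending on $a,c,K$) such that for every $T\ge T_0$, every $\mathfrak C>0$ and every (informed or uninformed) algorithm the following holds. If $$\mathrm{Reg}_{SW}(T,1)\le a\,\mathfrak C\sqrt{KT}$$ in every such environment, then for every integer $S\ge c\,\mathfrak C^2$ there is such an environment, with at most $S$ switches, in which $$\mathrm{Reg}_{SW}(T,S)\ \ge\ c'\min\Big\{\frac{S}{\mathfrak C}\sqrt{KT},\,T\Big\}.$$ -/

import Mathlib

noncomputable section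

namespace SwitchBandit

/-- What the agent sees in one round of a `K`-armed bandit: the number of switches up to that
round, the arm it played, and the loss of that arm. -/
structure Obs (K : ℕ) where
  switches : ℕ
  arm : Fin K
  loss : unitInterval

/-- A full record of one round: the number of switches up to that round, the arm played, and the
whole loss vector (a point of `[0,1]^K`). -/
structure Round (K : ℕ) where
  switches : ℕ
  arm : Fin K
  losses : Fin K → unitInterval

/-- The part of a round that is observed: only the loss of the arm played is revealed. -/
def Round.obs {K : ℕ} (r : Round K) : Obs K := ⟨r.switches, r.arm, r.losses r.arm⟩

/-- A (randomised) bandit algorithm: after `t` rounds, given the `t` past observations and the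
number of switches up to the current round, it chooses the law of the next arm. An algorithm that
is not informed about the switches is one that ignores these numbers. -/
structure Algorithm (K : ℕ) where
  act : (t : ℕ) → (Fin t → Obs K) → ℕ → PMF (Fin K)

/-- A stochastic bandit problem with adaptively timed switches. After `s` switches, the loss
vectors are independent samples of the fixed law `law s`, and each switch changes the law.
The number of switches up to the next round is decided from the observations made so far;
there is no switch before the first round and at most one between consecutive rounds. -/
structure Environment (K : ℕ) where
  law : ℕ → PMF (Fin K → unitInterval)
  law_ne : ∀ s, law s ≠ law (s + 1)
  switches : (t : ℕ) → (Fin t → Obs K) → ℕ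
  switches_zero : ∀ h : Fin 0 → Obs K, switches 0 h = 0
  switches_succ : ∀ (t : ℕ) (h : Fin (t + 1) → Obs K),
    switches (t + 1) h = switches t (Fin.init h) ∨
      switches (t + 1) h = switches t (Fin.init h) + 1

/-- The environment never switches more than `S` times. -/
def Environment.AtMostSwitches {K : ℕ} (E : Environment K) (S : ℕ) : Prop :=
  ∀ (t : ℕ) (h : Fin t → Obs K), E.switches t h ≤ S

/-- The law of the first `T` rounds of the game. Given the past, the arm played and the loss vector
of a round are independent. -/
def play {K : ℕ} (A : Algorithm K) (E : Environment K) : (T : ℕ) → PMF (Fin T → Round K)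
  | 0 => PMF.pure Fin.elim0
  | T + 1 =>
    (play A E T).bind fun ω =>
      let h : Fin T → Obs K := fun t => (ω t).obs
      let x : ℕ := E.switches T h
      (A.act T h x).bind fun a =>
        (E.law x).bind fun l =>
          PMF.pure (Fin.snoc (α := fun _ => Round K) ω ⟨x, a, l⟩)

/-- Expected value of a (bounded) real function under a discrete law. -/
def expectation {α : Type*} (p : PMF α) (f : α → ℝ) : ℝ := ∑' x, (p x).toReal * f x

/-- The sequences of `T` arms that change the arm at most `S` times. -/
def switchPolicies (K T S : ℕ) : Set (Fin T → Fin K) :=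
  {π | (Finset.univ.filter fun t : Fin T =>
    ∃ h : (t : ℕ) + 1 < T, π t ≠ π ⟨(t : ℕ) + 1, h⟩).card ≤ S}

/-- The pseudo-regret over `T` rounds against the sequences of arms with at most `S` switches:
`max_π E[∑_t (ℓ_{t, A_t} - ℓ_{t, π_t})]`, a maximum over a finite set. -/
def switchRegret {K : ℕ} (A : Algorithm K) (E : Environment K) (T S : ℕ) : ℝ :=
  ⨆ π : switchPolicies K T S,
    expectation (play A E T) fun ω =>
      ∑ t : Fin T, (((ω t).losses (ω t).arm : ℝ) - ((ω t).losses (π.1 t) : ℝ))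

end SwitchBandit

end

/-! Small regret against a fixed arm forces little exploration, and without exploration a change of
the best arm goes unnoticed. The rounds are cut into `blocks` blocks of length `len`. Arm `0` is
safe, with constant loss `1/2 - 7/8 * gap`; in each block a hidden arm, uniform among the others,
has mean loss `1/2 - gap`, and the remaining arms have mean `1/2`. An agent that identified the
hidden arm could recoup its exploration by playing it. Adaptive timing prevents this: the
improvement is withdrawn as soon as the observations of the block say too much. Until then no arm
has posterior probability above `3/4` (`le_mass_of_excess_le`), so every play of an arm other than
`0` costs on average at least `gap / 8` against arm `0` (`le_sum_meanRegret_safe`). If the regret is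
at most `R`, the expected number `N` of such plays is at most `8 * R / gap`.

Everything is computed under a reference measure in which no arm is ever improved
(`expectation_play_env`); the density of the uniform mixture factors over the blocks. Information is
gauged by `excess`, the mean of `ℓ - 1 - log ℓ` over the likelihood ratios. It is nonnegative, and
each exploring play in an active round raises its conditional mean by at most `4 * gap ^ 2 / (K -
1)`. A Markov bound then limits the number of idle rounds, those without an improved arm
(`sum_inactiveExp_le`). In all other rounds the sequence of hidden arms gains at least `gap / 8` on
the algorithm. A gap of order `K * blocks / R` keeps the idle rounds few and gives regret of order
`gap * T`, which is `S / C * √(K * T)` for `R = a * C * √(K * T)` and `blocks` about `S / 2`. -/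

noncomputable section

namespace SwitchBandit

open Finset

/-! ### Expectations under laws of finite support. -/

section Expectation

variable {α β : Type*}

theorem expectation_eq_sum {p : PMF α} {s : Finset α} (hs : p.support ⊆ s) (f : α → ℝ) :
    expectation p f = ∑ x ∈ s, (p x).toReal * f x := by
  refine tsum_eq_sum fun x hx => ?_
  have : p x = 0 := by
    by_contra h
    exact hx (hs ((p.mem_support_iff x).2 h))
  simp [this]

theorem expectation_pure (x : α) (f : α → ℝ) : expectation (PMF.pure x) f = f x := by
  classical
  rw [expectation_eq_sum (s := {x}) (by simp)]
  simp

theorem expectation_fintype [Fintype α] (p : PMF α) (f : α → ℝ) :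
    expectation p f = ∑ x, (p x).toReal * f x :=
  expectation_eq_sum (by simp) f

theorem finite_support_bind {p : PMF α} {q : α → PMF β} (hp : p.support.Finite)
    (hq : ∀ x, (q x).support.Finite) : (p.bind q).support.Finite := by
  rw [PMF.support_bind]
  exact hp.biUnion fun x _ => hq x

theorem expectation_bind {p : PMF α} {q : α → PMF β} (hp : p.support.Finite)
    (hq : ∀ x, (q x).support.Finite) (f : β → ℝ) :
    expectation (p.bind q) f = expectation p fun x => expectation (q x) f := by
  classical
  set s := hp.toFinset
  set r := (finite_support_bind hp hq).toFinset
  have hps : p.support ⊆ s := by simp [s]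
  rw [expectation_eq_sum (s := r) (by simp [r]), expectation_eq_sum hps]
  have h1 : ∀ x ∈ s, (p x).toReal * expectation (q x) f =
      ∑ y ∈ r, (p x).toReal * ((q x y).toReal * f y) := by
    intro x hx
    rw [expectation_eq_sum (s := r) (p := q x), mul_sum]
    intro y hy
    simp only [r, Set.Finite.coe_toFinset, PMF.support_bind, Set.mem_iUnion]
    exact ⟨x, by simpa [s] using hx, hy⟩
  rw [sum_congr rfl h1, sum_comm]
  refine sum_congr rfl fun y _ => ?_
  rw [PMF.bind_apply, tsum_eq_sum (s := s), ENNReal.toReal_sum, sum_mul]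
  · simp [mul_assoc]
  · intro x _
    exact ENNReal.mul_ne_top (p.apply_ne_top x) ((q x).apply_ne_top y)
  · intro x hx
    have : p x = 0 := by
      by_contra h
      exact hx (hps ((p.mem_support_iff x).2 h))
    simp [this]

theorem expectation_add {p : PMF α} (hp : p.support.Finite) (f g : α → ℝ) :
    expectation p (fun x => f x + g x) = expectation p f + expectation p g := by
  have h : p.support ⊆ hp.toFinset := by simp
  simp only [expectation_eq_sum h, mul_add, sum_add_distrib]

theorem expectation_const (p : PMF α) (c : ℝ) : expectation p (fun _ => c) = c := by
  have h : ∑' x, (p x).toReal = 1 := by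
    rw [← ENNReal.tsum_toReal_eq fun x => p.apply_ne_top x, p.tsum_coe, ENNReal.toReal_one]
  rw [expectation, tsum_mul_right, h, one_mul]

theorem sum_toReal_eq_one [Fintype α] (p : PMF α) : ∑ x, (p x).toReal = 1 := by
  simpa [expectation_fintype] using expectation_const p 1

/-- The law on a finite type with given real weights. -/
def weightedLaw [Fintype α] (w : α → ℝ) (h0 : ∀ x, 0 ≤ w x) (h1 : ∑ x, w x = 1) : PMF α :=
  PMF.ofFintype (fun x => ENNReal.ofReal (w x)) (by
    rw [← ENNReal.ofReal_sum_of_nonneg fun x _ => h0 x, h1, ENNReal.ofReal_one])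

theorem expectation_weightedLaw [Fintype α] (w : α → ℝ) (h0 : ∀ x, 0 ≤ w x)
    (h1 : ∑ x, w x = 1) (f : α → ℝ) :
    expectation (weightedLaw w h0 h1) f = ∑ x, w x * f x := by
  rw [expectation_fintype]
  refine sum_congr rfl fun x _ => ?_
  simp [weightedLaw, ENNReal.toReal_ofReal (h0 x)]

end Expectation

/-! ### The game round by round. -/

section Play

variable {K : ℕ}

/-- The observations contained in a record of the game. -/
def obsOf {t : ℕ} (ω : Fin t → Round K) : Fin t → Obs K := fun u => (ω u).obs

theorem obsOf_snoc {t : ℕ} (ω : Fin t → Round K) (r : Round K) :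
    obsOf (Fin.snoc (α := fun _ => Round K) ω r) =
      Fin.snoc (α := fun _ => Obs K) (obsOf ω) r.obs := by
  funext u
  refine Fin.lastCases ?_ (fun v => ?_) u <;> simp [obsOf]

variable (A : Algorithm K) (E : Environment K)

theorem finite_support_play (hE : ∀ s, (E.law s).support.Finite) (t : ℕ) :
    (play A E t).support.Finite := by
  induction t with
  | zero => simp [play]
  | succ t ih =>
    refine finite_support_bind ih fun ω => finite_support_bind (Set.toFinite _) fun a =>
      finite_support_bind (hE _) fun l => ?_
    simp

theorem expectation_play_succ (hE : ∀ s, (E.law s).support.Finite) (t : ℕ)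
    (F : (Fin (t + 1) → Round K) → ℝ) :
    expectation (play A E (t + 1)) F = expectation (play A E t) fun ω =>
      ∑ a, (A.act t (obsOf ω) (E.switches t (obsOf ω)) a).toReal *
        expectation (E.law (E.switches t (obsOf ω))) fun l =>
          F (Fin.snoc (α := fun _ => Round K) ω ⟨E.switches t (obsOf ω), a, l⟩) := by
  rw [play, expectation_bind (finite_support_play A E hE t)]
  · congr 1
    funext ω
    rw [expectation_bind (Set.toFinite _), expectation_fintype]
    · refine sum_congr rfl fun a _ => ?_
      rw [expectation_bind (hE _)]
      · simp only [expectation_pure]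
        rfl
      · simp
    · exact fun a => finite_support_bind (hE _) fun l => by simp
  · exact fun ω => finite_support_bind (Set.toFinite _) fun a =>
      finite_support_bind (hE _) fun l => by simp

/-- The expected regret is the sum over the rounds of the expected regret given the past. -/
theorem expectation_play_regret (hE : ∀ s, (E.law s).support.Finite) (T : ℕ) (p : ℕ → Fin K) :
    (expectation (play A E T) fun ω =>
      ∑ t : Fin T, (((ω t).losses (ω t).arm : ℝ) - ((ω t).losses (p t) : ℝ))) =
    ∑ t ∈ range T, expectation (play A E t) fun ω =>
      ∑ a, (A.act t (obsOf ω) (E.switches t (obsOf ω)) a).toReal *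
        (expectation (E.law (E.switches t (obsOf ω))) (fun l => (l a : ℝ)) -
          expectation (E.law (E.switches t (obsOf ω))) (fun l => (l (p t) : ℝ))) := by
  induction T with
  | zero => simp [expectation_const]
  | succ T ih =>
    rw [expectation_play_succ A E hE, sum_range_succ, ← ih,
      ← expectation_add (finite_support_play A E hE T)]
    congr 1
    funext ω
    have hsub : ∀ s (a : Fin K), expectation (E.law s) (fun l => (l a : ℝ) - (l (p T) : ℝ)) =
        expectation (E.law s) (fun l => (l a : ℝ)) -
          expectation (E.law s) (fun l => (l (p T) : ℝ)) := by
      intro s a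
      rw [eq_sub_iff_add_eq, ← expectation_add (hE s)]
      simp
    simp only [Fin.sum_univ_castSucc, Fin.snoc_castSucc, Fin.snoc_last, Fin.val_castSucc,
      Fin.val_last]
    simp only [expectation_add (hE _), expectation_const, mul_add, sum_add_distrib, ← sum_mul,
      sum_toReal_eq_one, one_mul, hsub]

end Play

/-! ### The hard environments. -/

/-- The parameters of the hard environments: the gap, the length and the number of blocks. -/
structure Design where
  gap : ℝ
  len : ℕ
  blocks : ℕ
  gap_pos : 0 < gap
  gap_le : gap ≤ 1 / 8
  two_le_len : 2 ≤ len
  one_le_blocks : 1 ≤ blocks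

namespace Design

variable {K : ℕ} [NeZero K] (D : Design)

/-- The constant loss of the safe arm `0`. -/
def safeLoss : unitInterval :=
  ⟨1 / 2 - 7 / 8 * D.gap, by have := D.gap_le; linarith, by have := D.gap_pos; linarith⟩

/-- The loss of an arm when the fair coin shows `b`. -/
def outcome (a : Fin K) (b : Bool) : unitInterval :=
  if a = 0 then D.safeLoss else if b then 1 else 0

/-- The loss vector for a fair coin `x.1` and a coin `x.2` that improves the arm `r`. -/
def lossVector (r : Fin K) (x : Bool × Bool) : Fin K → unitInterval := fun j =>
  if j = r ∧ j ≠ 0 ∧ x.2 then 0 else D.outcome j x.1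

/-- The law of the losses when the arm `r` is improved; no arm is improved if `r = 0`. -/
def lossLaw (r : Fin K) : PMF (Fin K → unitInterval) :=
  (weightedLaw (fun x : Bool × Bool => if x.2 then D.gap else 1 / 2 - D.gap)
    (fun x => by have := D.gap_pos; have := D.gap_le; split_ifs <;> linarith)
    (by simp [Fintype.sum_prod_type])).bind fun x => PMF.pure (D.lossVector r x)

/-- The likelihood ratio of the loss `l` of the arm `a`, between the law in which `r` is improved
and the law in which no arm is. -/
def ratio (r a : Fin K) (l : unitInterval) : ℝ :=
  if a = r ∧ a ≠ 0 then (if l = 0 then 1 + 2 * D.gap else 1 - 2 * D.gap) else 1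

/-- The mean loss of the arm `a` when the arm `r` is improved. -/
def mean (r a : Fin K) : ℝ :=
  if a = 0 then 1 / 2 - 7 / 8 * D.gap else if a = r then 1 / 2 - D.gap else 1 / 2

theorem ratio_zero (a : Fin K) (l : unitInterval) : D.ratio 0 a l = 1 := by
  rw [ratio, if_neg]
  rintro ⟨h, h'⟩
  exact h' h

theorem ratio_pos (r a : Fin K) (l : unitInterval) : 0 < D.ratio r a l := by
  have := D.gap_pos
  have := D.gap_le
  rw [ratio]
  split_ifs <;> linarith

theorem ratio_le (r a : Fin K) (l : unitInterval) : D.ratio r a l ≤ 5 / 4 := by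
  have := D.gap_pos
  have := D.gap_le
  rw [ratio]
  split_ifs <;> linarith

theorem finite_support_lossLaw (r : Fin K) : (D.lossLaw r).support.Finite :=
  finite_support_bind (Set.toFinite _) fun x => by simp

/-- The second coin has probability `2 * gap` and resets the improved arm to loss `0`, so the
weights `1/2, 1/2` of the losses `0, 1` become `1/2 + gap, 1/2 - gap`. Only one arm is observed per
round, so marginals suffice. -/
theorem expectation_lossLaw (r a : Fin K) (G : unitInterval → ℝ) :
    expectation (D.lossLaw r) (fun l => G (l a)) =
      (∑ b, D.ratio r a (D.outcome a b) * G (D.outcome a b)) / 2 := by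
  rw [lossLaw, expectation_bind (Set.toFinite _) fun x => by simp]
  simp only [expectation_pure, expectation_weightedLaw, Fintype.sum_prod_type, Fintype.sum_bool]
  by_cases h0 : a = 0
  · simp [lossVector, outcome, ratio, h0]
    ring
  · by_cases hr : a = r
    · subst hr
      simp [lossVector, outcome, ratio, h0]
      ring
    · simp [lossVector, outcome, ratio, h0, hr]
      ring

theorem expectation_loss (r a : Fin K) :
    expectation (D.lossLaw r) (fun l => (l a : ℝ)) = D.mean r a := by
  rw [D.expectation_lossLaw r a (fun l => (l : ℝ))]
  by_cases h0 : a = 0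
  · simp [outcome, ratio, mean, safeLoss, h0]
    ring
  · by_cases hr : a = r
    · subst hr
      simp [outcome, ratio, mean, h0]
      ring
    · simp [outcome, ratio, mean, h0, hr]

theorem lossLaw_ne {r : Fin K} (hr : r ≠ 0) : D.lossLaw r ≠ D.lossLaw 0 := by
  intro h
  have h1 := D.expectation_loss r r
  rw [h, expectation_loss] at h1
  have := D.gap_pos
  simp [mean, hr] at h1
  linarith

/-- The mean of a family of likelihood ratios over the arms other than `0`. -/
def _root_.SwitchBandit.mass (ℓ : Fin K → ℝ) : ℝ := (∑ j ∈ univ.erase 0, ℓ j) / ((K : ℝ) - 1)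

/-- The mean of `ℓ - 1 - log ℓ` over the arms other than `0`. -/
def _root_.SwitchBandit.excess (ℓ : Fin K → ℝ) : ℝ :=
  (∑ j ∈ univ.erase 0, (ℓ j - 1 - Real.log (ℓ j))) / ((K : ℝ) - 1)

/-- Whether some arm is improved in round `t`, given the likelihood ratios of the current block. -/
def ActiveAt (t : ℕ) (ℓ : Fin K → ℝ) : Prop :=
  t / D.len < D.blocks ∧ (t + 1) % D.len ≠ 0 ∧ excess ℓ ≤ 1 / 8

open scoped Classical in
/-- The likelihood ratio of the arm `j` being improved in the block `s`, after `t` rounds. -/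
def lik : (t : ℕ) → (Fin t → Obs K) → ℕ → Fin K → ℝ
  | 0, _, _, _ => 1
  | t + 1, h, s, j =>
    lik t (Fin.init h) s j *
      if s = t / D.len ∧ D.ActiveAt t (lik t (Fin.init h) s) then
        D.ratio j (h (Fin.last t)).arm (h (Fin.last t)).loss
      else 1

/-- Whether some arm is improved in round `t`, given the past. -/
def Active (t : ℕ) (h : Fin t → Obs K) : Prop := D.ActiveAt t (D.lik t h (t / D.len))

open scoped Classical in
/-- The number of switches up to round `t`: an arm is improved when it is even. -/
def switchCount (t : ℕ) (h : Fin t → Obs K) : ℕ :=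
  min (2 * (t / D.len) +
    if (t + 1) % D.len ≠ 0 ∧ excess (D.lik t h (t / D.len)) ≤ 1 / 8 then 0 else 1)
    (2 * D.blocks - 1)

open scoped Classical in
theorem lik_snoc (t : ℕ) (h : Fin t → Obs K) (o : Obs K) (s : ℕ) (j : Fin K) :
    D.lik (t + 1) (Fin.snoc (α := fun _ => Obs K) h o) s j =
      D.lik t h s j *
        if s = t / D.len ∧ D.Active t h then D.ratio j o.arm o.loss else 1 := by
  rw [lik, Fin.init_snoc, Fin.snoc_last, Active]
  congr 2
  apply propext
  constructor <;> rintro ⟨rfl, h2⟩ <;> exact ⟨rfl, h2⟩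

theorem lik_eq_one {t : ℕ} (h : Fin t → Obs K) {s : ℕ} (hs : t ≤ s * D.len) (j : Fin K) :
    D.lik t h s j = 1 := by
  induction t with
  | zero => rfl
  | succ t ih =>
    have h1 : s ≠ t / D.len := by
      have := (Nat.div_lt_iff_lt_mul (by have := D.two_le_len; omega : 0 < D.len)).2
        (Nat.lt_of_succ_le hs)
      omega
    rw [lik, ih _ (by omega), if_neg (fun h => h1 h.1), one_mul]

theorem lik_pos {t : ℕ} (h : Fin t → Obs K) (s : ℕ) (j : Fin K) : 0 < D.lik t h s j := by
  induction t with
  | zero => exact one_pos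
  | succ t ih =>
    rw [lik]
    refine mul_pos (ih _) ?_
    split_ifs
    · exact D.ratio_pos _ _ _
    · exact one_pos

theorem excess_eq_zero {ℓ : Fin K → ℝ} (h : ∀ j, ℓ j = 1) : excess ℓ = 0 := by
  simp [excess, h]

theorem switchCount_zero (h : Fin 0 → Obs K) : D.switchCount 0 h = 0 := by
  have h1 : excess (D.lik 0 h (0 / D.len)) = 0 := excess_eq_zero fun j => rfl
  have h2 : (0 + 1) % D.len ≠ 0 := by
    rw [Nat.mod_eq_of_lt (by have := D.two_le_len; omega)]
    omega
  rw [switchCount, if_pos ⟨h2, by rw [h1]; norm_num⟩]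
  simp

/-- Up to the cap, the count is `2 * s` while block `s` is active and `2 * s + 1` once it is idle.
The last round of a block is always idle, so a single switch leads into the next one, whose first
round is not its last because `2 ≤ len`. The count is a function of the observations and not of the
hidden arms, so it reveals nothing more about them. -/
theorem switchCount_succ (t : ℕ) (h : Fin (t + 1) → Obs K) :
    D.switchCount (t + 1) h = D.switchCount t (Fin.init h) ∨
      D.switchCount (t + 1) h = D.switchCount t (Fin.init h) + 1 := by
  have hB := D.two_le_len
  have hn := D.one_le_blocks
  by_cases hmod : (t + 1) % D.len = 0
  · have hdiv : (t + 1) / D.len = t / D.len + 1 := by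
      rw [Nat.succ_div, if_pos (Nat.dvd_of_mod_eq_zero hmod)]
    have h1 : excess (D.lik (t + 1) h (t / D.len + 1)) = 0 := by
      refine excess_eq_zero fun j => D.lik_eq_one h ?_ j
      rw [← hdiv, Nat.div_mul_cancel (Nat.dvd_of_mod_eq_zero hmod)]
    have h2 : (t + 1 + 1) % D.len ≠ 0 := by
      rw [Nat.add_mod, hmod, zero_add, Nat.mod_mod, Nat.mod_eq_of_lt (by omega)]
      omega
    rw [switchCount, switchCount, hdiv, if_pos ⟨h2, by rw [h1]; norm_num⟩,
      if_neg (fun h => h.1 hmod)]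
    omega
  · have hdiv : (t + 1) / D.len = t / D.len := by
      rw [Nat.succ_div, if_neg (fun h => hmod (Nat.mod_eq_zero_of_dvd h))]
      rfl
    rw [switchCount, switchCount, hdiv]
    by_cases hex : excess (D.lik t (Fin.init h) (t / D.len)) ≤ 1 / 8
    · rw [if_pos (⟨hmod, hex⟩ : (t + 1) % D.len ≠ 0 ∧ _)]
      split_ifs <;> omega
    -- Ratios are frozen in idle rounds, so a block that became idle stays idle to its end.
    · have heq : D.lik (t + 1) h (t / D.len) = D.lik t (Fin.init h) (t / D.len) := by
        funext j
        rw [lik, if_neg (fun h => hex h.2.2.2), mul_one]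
      rw [heq, if_neg (fun h => hex h.2), if_neg (fun h => hex h.2)]
      exact Or.inl rfl

/-- The arm that is improved in round `t`, given the past; `0` if there is none. -/
def improved (i : ℕ → Fin K) (x : ℕ) : Fin K := if Even x then i (x / 2) else 0

-- Odd counts are the idle phases. The cap `2 * blocks - 1` is odd, so no arm is improved after the
-- last block.
open scoped Classical in
theorem improved_switchCount (i : ℕ → Fin K) (t : ℕ) (h : Fin t → Obs K) :
    improved i (D.switchCount t h) = if D.Active t h then i (t / D.len) else 0 := by
  have hn := D.one_le_blocks
  by_cases hA : D.Active t h
  · have h1 : D.switchCount t h = 2 * (t / D.len) := by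
      rw [switchCount, if_pos hA.2]
      have := hA.1
      omega
    simp [improved, if_pos hA, h1]
  · have h1 : ¬ Even (D.switchCount t h) := by
      rw [Nat.not_even_iff_odd, switchCount]
      by_cases hlt : t / D.len < D.blocks
      · rw [if_neg (fun h => hA ⟨hlt, h⟩), min_eq_left (by omega)]
        exact ⟨t / D.len, rfl⟩
      · rw [min_eq_right (by split_ifs <;> omega)]
        exact ⟨D.blocks - 1, by omega⟩
    rw [improved, if_neg h1, if_neg hA]

/-- The environment in which the arm `i s` is improved in the block `s`, until the likelihood
ratios of the block are too far from `1`. -/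
def env (i : ℕ → Fin K) (hi : ∀ s, i s ≠ 0) : Environment K where
  law x := D.lossLaw (improved i x)
  law_ne x := by
    rcases Nat.even_or_odd x with hx | hx
    · have h1 : ¬ Even (x + 1) := by simpa [Nat.even_add_one] using hx
      simp only [improved, if_pos hx, if_neg h1]
      exact D.lossLaw_ne (hi _)
    · have h0 : ¬ Even x := Nat.not_even_iff_odd.2 hx
      have h1 : Even (x + 1) := by simpa [Nat.even_add_one] using h0
      simp only [improved, if_pos h1, if_neg h0]
      exact (D.lossLaw_ne (hi _)).symm
  switches := D.switchCount
  switches_zero := D.switchCount_zero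
  switches_succ := D.switchCount_succ

theorem env_atMostSwitches (i : ℕ → Fin K) (hi : ∀ s, i s ≠ 0) :
    (D.env i hi).AtMostSwitches (2 * D.blocks - 1) := fun _ _ => min_le_right _ _

/-! ### Change of measure. -/

variable (A : Algorithm K)

/-- One step of the reference measure, under which no arm is ever improved. -/
def nullStep (t : ℕ) (h : Fin t → Obs K) (F : (Fin (t + 1) → Obs K) → ℝ) : ℝ :=
  ∑ a, (A.act t h (D.switchCount t h) a).toReal *
    ((∑ b, F (Fin.snoc (α := fun _ => Obs K) h ⟨D.switchCount t h, a, D.outcome a b⟩)) / 2)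

/-- Expectation under the reference measure. -/
def nullExp : (t : ℕ) → ((Fin t → Obs K) → ℝ) → ℝ
  | 0, F => F Fin.elim0
  | t + 1, F => nullExp t fun h => D.nullStep A t h F

/-- Only the factor of the current block can move. In an idle round the improved arm is `0`, whose
ratio is `1`. -/
theorem prod_lik_snoc (i : ℕ → Fin K) (t : ℕ) (h : Fin t → Obs K) (o : Obs K) :
    ∏ s ∈ range D.blocks, D.lik (t + 1) (Fin.snoc (α := fun _ => Obs K) h o) s (i s) =
      (∏ s ∈ range D.blocks, D.lik t h s (i s)) *
        D.ratio (improved i (D.switchCount t h)) o.arm o.loss := by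
  classical
  simp only [lik_snoc, prod_mul_distrib, improved_switchCount]
  congr 1
  by_cases hA : D.Active t h
  · simp only [hA, and_true, if_true]
    rw [prod_ite_eq', if_pos (mem_range.2 hA.1)]
  · simp [hA, ratio_zero]

/-- Change of measure: the environments are absolutely continuous with respect to the reference
measure. -/
theorem expectation_play_env (i : ℕ → Fin K) (hi : ∀ s, i s ≠ 0) (t : ℕ)
    (F : (Fin t → Obs K) → ℝ) :
    expectation (play A (D.env i hi) t) (fun ω => F (obsOf ω)) =
      D.nullExp A t fun h => F h * ∏ s ∈ range D.blocks, D.lik t h s (i s) := by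
  induction t with
  | zero =>
    rw [play, expectation_pure, nullExp]
    simp only [lik, prod_const_one, mul_one]
    congr 1
    exact Subsingleton.elim _ _
  | succ t ih =>
    rw [expectation_play_succ A _ (fun s => D.finite_support_lossLaw _), nullExp]
    simp only [obsOf_snoc]
    have key := ih fun h => ∑ a, (A.act t h (D.switchCount t h) a).toReal *
      ((∑ b, D.ratio (improved i (D.switchCount t h)) a (D.outcome a b) *
        F (Fin.snoc (α := fun _ => Obs K) h ⟨D.switchCount t h, a, D.outcome a b⟩)) / 2)
    convert key using 2
    · funext ω
      refine sum_congr rfl fun a _ => ?_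
      congr 1
      exact D.expectation_lossLaw _ a fun l =>
        F (Fin.snoc (α := fun _ => Obs K) (obsOf ω) ⟨D.switchCount t (obsOf ω), a, l⟩)
    · funext h
      rw [nullStep, sum_mul]
      refine sum_congr rfl fun a _ => ?_
      simp only [prod_lik_snoc, Fintype.sum_bool]
      ring

/-- The expected regret in one of the hard environments, under the reference measure. -/
theorem expectation_play_env_regret (i : ℕ → Fin K) (hi : ∀ s, i s ≠ 0) (T : ℕ)
    (p : ℕ → Fin K) :
    (expectation (play A (D.env i hi) T) fun ω =>
      ∑ t : Fin T, (((ω t).losses (ω t).arm : ℝ) - ((ω t).losses (p t) : ℝ))) =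
    ∑ t ∈ range T, D.nullExp A t fun h =>
      (∑ a, (A.act t h (D.switchCount t h) a).toReal *
        (D.mean (improved i (D.switchCount t h)) a -
          D.mean (improved i (D.switchCount t h)) (p t))) *
        ∏ s ∈ range D.blocks, D.lik t h s (i s) := by
  rw [expectation_play_regret A _ (fun s => D.finite_support_lossLaw _)]
  refine sum_congr rfl fun t _ => ?_
  rw [← D.expectation_play_env A i hi]
  congr 1
  funext ω
  refine sum_congr rfl fun a _ => ?_
  simp only [env, expectation_loss]

end Design

/-! ### What a small excess says about the likelihood ratios. -/

section LikelihoodMeans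

variable {K : ℕ} [NeZero K] {ℓ : Fin K → ℝ}

theorem card_erase_zero : ((univ.erase (0 : Fin K)).card : ℝ) = (K : ℝ) - 1 := by
  rw [card_erase_of_mem (mem_univ _), card_univ, Fintype.card_fin, Nat.cast_sub, Nat.cast_one]
  exact NeZero.one_le

/-- The tangent of `log` at `r`. Suitable choices of `r` give the linear lower bounds on the excess
used below. -/
theorem log_le_div_add {x r : ℝ} (hx : 0 < x) (hr : 0 < r) :
    Real.log x ≤ x / r - 1 + Real.log r := by
  have := Real.log_le_sub_one_of_pos (div_pos hx hr)
  rw [Real.log_div hx.ne' hr.ne'] at this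
  linarith

theorem excess_nonneg (hK : 3 ≤ K) (hℓ : ∀ j, 0 < ℓ j) : 0 ≤ excess ℓ := by
  have hK' : (3 : ℝ) ≤ K := by exact_mod_cast hK
  refine div_nonneg (sum_nonneg fun j _ => ?_) (by linarith)
  linarith [Real.log_le_sub_one_of_pos (hℓ j)]

theorem mass_pos (hK : 3 ≤ K) (hℓ : ∀ j, 0 < ℓ j) : 0 < mass ℓ := by
  have hK' : (3 : ℝ) ≤ K := by exact_mod_cast hK
  refine div_pos (sum_pos (fun j _ => hℓ j) ?_) (by linarith)
  rw [← card_pos, ← Nat.cast_pos (α := ℝ), card_erase_zero]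
  linarith

theorem le_excess (hK : 3 ≤ K) (hℓ : ∀ j, 0 < ℓ j) {r : ℝ} (hr : 0 < r) :
    (1 - 1 / r) * mass ℓ - Real.log r ≤ excess ℓ := by
  have hK' : (3 : ℝ) ≤ K := by exact_mod_cast hK
  have h0 : (0 : ℝ) < (K : ℝ) - 1 := by linarith
  rw [excess, le_div_iff₀ h0, sub_mul, mul_assoc, mass, div_mul_cancel₀ _ h0.ne',
    ← card_erase_zero (K := K), mul_comm (Real.log r), ← nsmul_eq_mul, ← sum_const, mul_sum,
    ← sum_sub_distrib]
  refine sum_le_sum fun j _ => ?_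
  have := log_le_div_add (hℓ j) hr
  have h2 : (1 - 1 / r) * ℓ j = ℓ j - ℓ j / r := by ring
  linarith

theorem mass_le_two (hK : 3 ≤ K) (hℓ : ∀ j, 0 < ℓ j) (h : excess ℓ ≤ 1 / 8) : mass ℓ ≤ 2 := by
  have h1 := le_excess hK hℓ (r := 2) (by norm_num)
  have := Real.log_two_lt_d9
  linarith

theorem half_le_mass (hK : 3 ≤ K) (hℓ : ∀ j, 0 < ℓ j) (h : excess ℓ ≤ 1 / 8) :
    1 / 2 ≤ mass ℓ := by
  have h1 := le_excess hK hℓ (r := 1 / 2) (by norm_num)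
  have h2 : Real.log (1 / 2) = -Real.log 2 := by simp
  have := Real.log_two_gt_d9
  rw [h2] at h1
  norm_num at h1
  linarith

/-- While the excess is small, no arm has more than three quarters of the posterior mass. -/
theorem le_mass_of_excess_le (hK : 3 ≤ K) (hℓ : ∀ j, 0 < ℓ j) (h : excess ℓ ≤ 1 / 8) {a : Fin K}
    (ha : a ≠ 0) : ℓ a / ((K : ℝ) - 1) ≤ 3 / 4 * mass ℓ := by
  have hK' : (3 : ℝ) ≤ K := by exact_mod_cast hK
  have h0 : (0 : ℝ) < (K : ℝ) - 1 := by linarith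
  have hmem : a ∈ univ.erase (0 : Fin K) := by simp [ha]
  rw [mass, mul_div_assoc', div_le_div_iff_of_pos_right h0]
  by_contra! hlt
  rw [excess, div_le_iff₀ h0, ← add_sum_erase _ _ hmem] at h
  rw [← add_sum_erase _ _ hmem] at hlt
  set s := (univ.erase (0 : Fin K)).erase a
  have hcard : (s.card : ℝ) = (K : ℝ) - 1 - 1 := by
    rw [← card_erase_zero (K := K), ← card_erase_add_one hmem]
    simp [s]
  -- Tangents at `1/2` for the other arms and at `3/2` for `a` have slopes `-1` and `1/3`, so a
  -- share above `3/4` makes the linear part positive. What remains is `(K - 3) * log 2 + log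
  -- (4/3)`, which exceeds `(K - 1) / 8` because `log (4/3) ≥ 1/4`.
  have h1 : ∑ j ∈ s, (-ℓ j + Real.log 2) ≤ ∑ j ∈ s, (ℓ j - 1 - Real.log (ℓ j)) := by
    refine sum_le_sum fun j _ => ?_
    have := log_le_div_add (hℓ j) (r := 1 / 2) (by norm_num)
    have h2 : Real.log (1 / 2) = -Real.log 2 := by simp
    rw [h2] at this
    linarith
  rw [sum_add_distrib, sum_neg_distrib, sum_const, nsmul_eq_mul, hcard] at h1
  have h2 := log_le_div_add (hℓ a) (r := 3 / 2) (by norm_num)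
  have h3 : Real.log (3 / 2) = Real.log 2 - Real.log (4 / 3) := by
    rw [← Real.log_div (by norm_num) (by norm_num)]
    norm_num
  have h4 : 1 / 4 ≤ Real.log (4 / 3) := by
    have := Real.one_sub_inv_le_log_of_pos (x := 4 / 3) (by norm_num)
    norm_num at this ⊢
    linarith
  have h5 := Real.log_two_gt_d9
  have h6 : 0 ≤ ((K : ℝ) - 3) * (Real.log 2 - 1 / 8) := by
    apply mul_nonneg <;> linarith
  nlinarith

end LikelihoodMeans

/-! ### One-step evolution of mass and excess. -/

namespace Design

variable {K : ℕ} [NeZero K] (D : Design)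

/-- While the block is active the mass is at most `2`. The round that ends activity overshoots by a
factor of at most `5/4`, and the mass is frozen afterwards. -/
theorem mass_lik_le (hK : 3 ≤ K) {t : ℕ} (h : Fin t → Obs K) (s : ℕ) :
    mass (D.lik t h s) ≤ 3 := by
  have hK' : (3 : ℝ) ≤ K := by exact_mod_cast hK
  have h0 : (0 : ℝ) < (K : ℝ) - 1 := by linarith
  induction t with
  | zero =>
    rw [mass]
    simp only [lik, sum_const, nsmul_eq_mul, mul_one]
    rw [card_erase_zero, div_self h0.ne']
    norm_num
  | succ t ih =>
    by_cases hA : s = t / D.len ∧ D.ActiveAt t (D.lik t (Fin.init h) s)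
    · have h1 : mass (D.lik (t + 1) h s) ≤ 5 / 4 * mass (D.lik t (Fin.init h) s) := by
        rw [mass, mass, mul_div_assoc', div_le_div_iff_of_pos_right h0, mul_sum]
        refine sum_le_sum fun j _ => ?_
        rw [lik, if_pos hA, mul_comm]
        exact mul_le_mul_of_nonneg_right (D.ratio_le _ _ _) (D.lik_pos _ _ _).le
      have h2 := mass_le_two hK (D.lik_pos _ _) hA.2.2.2
      linarith
    · have h1 : D.lik (t + 1) h s = D.lik t (Fin.init h) s := by
        funext j
        rw [lik, if_neg hA, mul_one]
      rw [h1]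
      exact ih _

theorem sum_ratio (r a : Fin K) : ∑ b, D.ratio r a (D.outcome a b) = 2 := by
  by_cases h0 : a = 0
  · simp [ratio, h0]
  · by_cases hr : a = r
    · subst hr
      simp [ratio, outcome, h0]
      ring
    · simp [ratio, hr]

/-- The expected growth of `-log` of the likelihood ratio of an arm, when this arm is played. -/
def drift : ℝ := -Real.log (1 - 4 * D.gap ^ 2) / 2

theorem drift_nonneg : 0 ≤ D.drift := by
  have := D.gap_pos
  have := D.gap_le
  have h1 : Real.log (1 - 4 * D.gap ^ 2) ≤ 0 := Real.log_nonpos (by nlinarith) (by nlinarith)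
  rw [drift]
  linarith

theorem drift_le : D.drift ≤ 4 * D.gap ^ 2 := by
  have := D.gap_pos
  have := D.gap_le
  have h2 : 4 * D.gap ^ 2 ≤ 1 / 2 := by nlinarith
  have h1 := Real.one_sub_inv_le_log_of_pos (x := 1 - 4 * D.gap ^ 2) (by linarith)
  have h3 : (1 - 4 * D.gap ^ 2)⁻¹ ≤ 1 + 2 * (4 * D.gap ^ 2) := by
    rw [inv_le_comm₀ (by linarith) (by positivity), ← one_div, div_le_iff₀ (by positivity)]
    nlinarith [sq_nonneg D.gap]
  rw [drift]
  linarith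

open scoped Classical in
theorem sum_log_ratio (r a : Fin K) :
    ∑ b, Real.log (D.ratio r a (D.outcome a b)) =
      if a = r ∧ a ≠ 0 then -(2 * D.drift) else 0 := by
  have := D.gap_pos
  have := D.gap_le
  by_cases h : a = r ∧ a ≠ 0
  · have h2 : (1 - 4 * D.gap ^ 2) = (1 - 2 * D.gap) * (1 + 2 * D.gap) := by ring
    rw [if_pos h, drift, h2, Real.log_mul (by linarith) (by linarith)]
    simp [ratio, outcome, h.1, h.1 ▸ h.2]
    ring
  · simp [ratio, h]

section Step

variable (t : ℕ) (h : Fin t → Obs K) (a : Fin K)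

/-- The past after one more round. -/
def next (b : Bool) : Fin (t + 1) → Obs K :=
  Fin.snoc (α := fun _ => Obs K) h ⟨D.switchCount t h, a, D.outcome a b⟩

theorem lik_next_of_ne {s : ℕ} (hs : s ≠ t / D.len) (b : Bool) :
    D.lik (t + 1) (D.next t h a b) s = D.lik t h s := by
  funext j
  rw [next, lik_snoc, if_neg (fun h => hs h.1), mul_one]

theorem sum_lik_next (s : ℕ) (j : Fin K) :
    ∑ b, D.lik (t + 1) (D.next t h a b) s j = 2 * D.lik t h s j := by
  simp only [next, lik_snoc, ← mul_sum]
  split_ifs with h1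
  · rw [sum_ratio, mul_comm]
  · simp
    ring

theorem sum_mass_next (s : ℕ) :
    ∑ b, mass (D.lik (t + 1) (D.next t h a b) s) = 2 * mass (D.lik t h s) := by
  simp only [mass, ← sum_div]
  rw [sum_comm]
  simp only [sum_lik_next, ← mul_sum, mul_div_assoc]

-- The part `ℓ - 1` is a martingale under the reference measure, so only `-log` contributes, and
-- only through the ratio of the arm played.
open scoped Classical in
theorem sum_excess_next (s : ℕ) :
    ∑ b, excess (D.lik (t + 1) (D.next t h a b) s) =
      2 * (excess (D.lik t h s) +
        if s = t / D.len ∧ D.Active t h ∧ a ≠ 0 then D.drift / ((K : ℝ) - 1) else 0) := by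
  by_cases hA : s = t / D.len ∧ D.Active t h
  · have h1 : ∀ j, ∑ b, (D.lik (t + 1) (D.next t h a b) s j - 1 -
        Real.log (D.lik (t + 1) (D.next t h a b) s j)) =
        2 * (D.lik t h s j - 1 - Real.log (D.lik t h s j)) +
          if a = j ∧ a ≠ 0 then 2 * D.drift else 0 := by
      intro j
      rw [sum_sub_distrib, sum_sub_distrib, sum_lik_next]
      have h2 : ∀ b, Real.log (D.lik (t + 1) (D.next t h a b) s j) =
          Real.log (D.lik t h s j) + Real.log (D.ratio j a (D.outcome a b)) := by
        intro b
        rw [next, lik_snoc, if_pos hA,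
          Real.log_mul (D.lik_pos _ _ _).ne' (D.ratio_pos _ _ _).ne']
      simp only [h2, sum_add_distrib, sum_log_ratio]
      split_ifs <;> simp <;> ring
    simp only [excess, ← sum_div]
    rw [sum_comm]
    simp only [h1, sum_add_distrib, ← mul_sum]
    by_cases ha : a = 0
    · simp [ha, mul_div_assoc]
    · have h2 : ∑ j ∈ univ.erase (0 : Fin K), (if a = j ∧ a ≠ 0 then 2 * D.drift else 0) =
          2 * D.drift := by
        simp [ha]
      rw [h2, if_pos ⟨hA.1, hA.2, ha⟩]
      ring
  · have h1 : ∀ b, D.lik (t + 1) (D.next t h a b) s = D.lik t h s := by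
      intro b
      funext j
      rw [next, lik_snoc, if_neg hA, mul_one]
    rw [if_neg (fun h => hA ⟨h.1, h.2.1⟩)]
    simp [h1]

/-- One step of a product of functions of the likelihood ratios of the blocks. -/
theorem sum_prod_next (S : Finset ℕ) (φ : ℕ → (Fin K → ℝ) → ℝ) (c : ℝ)
    (hφ : ∑ b, φ (t / D.len) (D.lik (t + 1) (D.next t h a b) (t / D.len)) =
      2 * (φ (t / D.len) (D.lik t h (t / D.len)) + c)) :
    ∑ b, ∏ s ∈ S, φ s (D.lik (t + 1) (D.next t h a b) s) =
      2 * (∏ s ∈ S, φ s (D.lik t h s) +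
        if t / D.len ∈ S then c * ∏ s ∈ S.erase (t / D.len), φ s (D.lik t h s) else 0) := by
  have h1 : ∀ (S : Finset ℕ), t / D.len ∉ S → ∀ b,
      ∏ s ∈ S, φ s (D.lik (t + 1) (D.next t h a b) s) = ∏ s ∈ S, φ s (D.lik t h s) := by
    intro S hS b
    refine prod_congr rfl fun s hs => ?_
    rw [lik_next_of_ne]
    rintro rfl
    exact hS hs
  by_cases hS : t / D.len ∈ S
  · simp only [← mul_prod_erase S _ hS, h1 _ (notMem_erase _ S), if_pos hS]
    rw [← sum_mul, hφ]
    ring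
  · simp only [h1 S hS, if_neg hS]
    simp

end Step

end Design

namespace Design

variable {K : ℕ} [NeZero K] (D : Design) (A : Algorithm K)

/-! ### Linearity and monotonicity of the reference expectation. -/

section NullExp

theorem nullExp_mono {t : ℕ} {F G : (Fin t → Obs K) → ℝ} (hFG : ∀ h, F h ≤ G h) :
    D.nullExp A t F ≤ D.nullExp A t G := by
  induction t with
  | zero => exact hFG _
  | succ t ih =>
    refine ih fun h => sum_le_sum fun a _ => mul_le_mul_of_nonneg_left ?_ ENNReal.toReal_nonneg
    exact div_le_div_of_nonneg_right (sum_le_sum fun b _ => hFG _) zero_le_two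

theorem nullExp_const_mul {t : ℕ} (c : ℝ) (F : (Fin t → Obs K) → ℝ) :
    D.nullExp A t (fun h => c * F h) = c * D.nullExp A t F := by
  induction t with
  | zero => rfl
  | succ t ih =>
    rw [nullExp, nullExp, ← ih]
    congr 1
    funext h
    rw [nullStep, nullStep, mul_sum]
    refine sum_congr rfl fun a _ => ?_
    rw [← mul_sum]
    ring

theorem nullExp_add {t : ℕ} (F G : (Fin t → Obs K) → ℝ) :
    D.nullExp A t (fun h => F h + G h) = D.nullExp A t F + D.nullExp A t G := by
  induction t with
  | zero => rfl
  | succ t ih =>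
    rw [nullExp, nullExp, nullExp, ← ih]
    congr 1
    funext h
    simp only [nullStep]
    rw [← sum_add_distrib]
    refine sum_congr rfl fun a _ => ?_
    rw [sum_add_distrib]
    ring

theorem nullExp_zero (t : ℕ) : D.nullExp A t (fun _ => 0) = 0 := by
  simpa using D.nullExp_const_mul A (t := t) 0 fun _ => 0

theorem nullExp_sum {t : ℕ} {ι : Type*} (s : Finset ι) (F : ι → (Fin t → Obs K) → ℝ) :
    D.nullExp A t (fun h => ∑ i ∈ s, F i h) = ∑ i ∈ s, D.nullExp A t (F i) := by
  classical
  induction s using Finset.induction_on with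
  | empty => simpa using D.nullExp_zero A t
  | insert i s hi ih => simp only [sum_insert hi, nullExp_add, ih]

end NullExp

/-! ### The mixture density and the growth of information. -/

section Weights

/-- The density of the uniform mixture of the environments, in terms of the reference measure. -/
def weight (t : ℕ) (h : Fin t → Obs K) : ℝ := ∏ s ∈ range D.blocks, mass (D.lik t h s)

/-- The density of the mixture without the factor of the block `s`. -/
def weightExcept (t : ℕ) (h : Fin t → Obs K) (s : ℕ) : ℝ :=
  ∏ u ∈ (range D.blocks).erase s, mass (D.lik t h u)

/-- The weighted excess of the block `s`. -/
def potential (t : ℕ) (h : Fin t → Obs K) (s : ℕ) : ℝ :=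
  D.weightExcept t h s * excess (D.lik t h s)

/-- The probability that an arm other than `0` is played next. -/
def explore (t : ℕ) (h : Fin t → Obs K) : ℝ :=
  ∑ a ∈ univ.erase 0, (A.act t h (D.switchCount t h) a).toReal

theorem explore_nonneg (t : ℕ) (h : Fin t → Obs K) : 0 ≤ D.explore A t h :=
  sum_nonneg fun _ _ => ENNReal.toReal_nonneg

theorem explore_le_one (t : ℕ) (h : Fin t → Obs K) : D.explore A t h ≤ 1 := by
  rw [← sum_toReal_eq_one (A.act t h (D.switchCount t h))]
  exact sum_le_sum_of_subset_of_nonneg (erase_subset _ _) fun _ _ _ => ENNReal.toReal_nonneg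

theorem weight_nonneg (hK : 3 ≤ K) (t : ℕ) (h : Fin t → Obs K) : 0 ≤ D.weight t h :=
  prod_nonneg fun _ _ => (mass_pos hK (D.lik_pos _ _)).le

theorem weightExcept_nonneg (hK : 3 ≤ K) (t : ℕ) (h : Fin t → Obs K) (s : ℕ) :
    0 ≤ D.weightExcept t h s :=
  prod_nonneg fun _ _ => (mass_pos hK (D.lik_pos _ _)).le

theorem mass_mul_weightExcept (t : ℕ) (h : Fin t → Obs K) {s : ℕ} (hs : s < D.blocks) :
    mass (D.lik t h s) * D.weightExcept t h s = D.weight t h :=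
  mul_prod_erase (range D.blocks) (fun s => mass (D.lik t h s)) (mem_range.2 hs)

theorem potential_eq_prod (t : ℕ) (h : Fin t → Obs K) {s : ℕ} (hs : s < D.blocks) :
    D.potential t h s =
      ∏ u ∈ range D.blocks, if u = s then excess (D.lik t h u) else mass (D.lik t h u) := by
  rw [← mul_prod_erase _ _ (mem_range.2 hs), if_pos rfl, potential, weightExcept, mul_comm]
  congr 1
  exact prod_congr rfl fun u hu => (if_neg (ne_of_mem_erase hu)).symm

theorem nullStep_weight (t : ℕ) (h : Fin t → Obs K) :
    D.nullStep A t h (D.weight (t + 1)) = D.weight t h := by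
  have h1 : ∀ a : Fin K, ∑ b, D.weight (t + 1) (D.next t h a b) = 2 * D.weight t h := by
    intro a
    have := D.sum_prod_next t h a (range D.blocks) (fun _ => mass) 0
      (by rw [add_zero, sum_mass_next])
    simpa [weight] using this
  have h2 : ∀ a : Fin K, (∑ b, D.weight (t + 1) (D.next t h a b)) / 2 = D.weight t h := by
    intro a
    rw [h1]
    ring
  change ∑ a, (A.act t h (D.switchCount t h) a).toReal *
    ((∑ b, D.weight (t + 1) (D.next t h a b)) / 2) = _
  simp only [h2]
  rw [← sum_mul, sum_toReal_eq_one, one_mul]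

theorem mass_one (hK : 3 ≤ K) {ℓ : Fin K → ℝ} (h : ∀ j, ℓ j = 1) : mass ℓ = 1 := by
  have hK' : (3 : ℝ) ≤ K := by exact_mod_cast hK
  simp only [mass, h, sum_const, nsmul_eq_mul, mul_one]
  rw [card_erase_zero, div_self (by linarith)]

theorem nullExp_weight (hK : 3 ≤ K) (t : ℕ) : D.nullExp A t (D.weight t) = 1 := by
  induction t with
  | zero =>
    change ∏ s ∈ range D.blocks, mass (D.lik 0 Fin.elim0 s) = 1
    exact prod_eq_one fun s _ => mass_one hK fun j => rfl
  | succ t ih =>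
    rw [nullExp, ← ih]
    simp only [nullStep_weight]

/-- Omitting the mass of block `s` measures its excess as if that block had no improved arm, where
the drift is explicit. The factor `2` restores the mixture weight: the excess grows only in active
rounds, where the mass is at least `1/2`. -/
theorem nullStep_potential_le (hK : 3 ≤ K) (t : ℕ) (h : Fin t → Obs K) {s : ℕ}
    (hs : s < D.blocks) :
    D.nullStep A t h (fun h' => D.potential (t + 1) h' s) ≤ D.potential t h s +
      if s = t / D.len then 2 * D.drift / ((K : ℝ) - 1) * (D.weight t h * D.explore A t h)
      else 0 := by
  classical
  have hK' : (3 : ℝ) ≤ K := by exact_mod_cast hK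
  have hd : 0 ≤ D.drift / ((K : ℝ) - 1) := div_nonneg D.drift_nonneg (by linarith)
  have h1 : ∀ a : Fin K, (∑ b, D.potential (t + 1) (D.next t h a b) s) / 2 ≤
      D.potential t h s + if s = t / D.len ∧ a ≠ 0 then
        2 * D.drift / ((K : ℝ) - 1) * D.weight t h else 0 := by
    intro a
    simp only [D.potential_eq_prod _ _ hs]
    have key := D.sum_prod_next t h a (range D.blocks)
      (fun u ℓ => if u = s then excess ℓ else mass ℓ)
      (if s = t / D.len ∧ D.Active t h ∧ a ≠ 0 then D.drift / ((K : ℝ) - 1) else 0) (by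
        by_cases hst : t / D.len = s
        · rw [hst]
          simp only [if_true]
          rw [sum_excess_next]
          simp only [hst, true_and]
        · have hst' : ¬ (s = t / D.len ∧ D.Active t h ∧ a ≠ 0) := fun h => hst h.1.symm
          simp only [if_neg hst, sum_mass_next, if_neg hst', add_zero])
    rw [key, mul_div_cancel_left₀ _ two_ne_zero]
    refine add_le_add le_rfl ?_
    by_cases hst : s = t / D.len
    · have hW : ∏ u ∈ (range D.blocks).erase (t / D.len),
          (if u = s then excess (D.lik t h u) else mass (D.lik t h u)) =
          D.weightExcept t h s := by
        rw [weightExcept, hst]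
        exact prod_congr rfl fun u hu => if_neg (ne_of_mem_erase hu)
      have hW0 := D.weight_nonneg hK t h
      have hE0 := D.weightExcept_nonneg hK t h s
      rw [if_pos (mem_range.2 (hst ▸ hs)), hW]
      by_cases ha : a ≠ 0
      · by_cases hA : D.Active t h
        · rw [if_pos ⟨hst, hA, ha⟩, if_pos ⟨hst, ha⟩, ← D.mass_mul_weightExcept t h hs]
          have h2 := half_le_mass hK (D.lik_pos _ _) hA.2.2
          rw [← hst] at h2
          have h3 := mul_le_mul_of_nonneg_right h2 (mul_nonneg hd hE0)
          have h4 : 2 * D.drift / ((K : ℝ) - 1) *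
              (mass (D.lik t h s) * D.weightExcept t h s) =
              2 * (mass (D.lik t h s) * (D.drift / ((K : ℝ) - 1) * D.weightExcept t h s)) := by
            ring
          rw [h4]
          linarith
        · rw [if_neg (fun h => hA h.2.1), if_pos ⟨hst, ha⟩, zero_mul, mul_div_assoc]
          positivity
      · rw [if_neg (fun h => ha h.2.2), if_neg (fun h => ha h.2), zero_mul]
    · simp [hst]
  change ∑ a, (A.act t h (D.switchCount t h) a).toReal *
    ((∑ b, D.potential (t + 1) (D.next t h a b) s) / 2) ≤ _
  refine (sum_le_sum fun a _ => mul_le_mul_of_nonneg_left (h1 a) ENNReal.toReal_nonneg).trans ?_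
  simp only [mul_add, sum_add_distrib, ← sum_mul, sum_toReal_eq_one, one_mul]
  refine add_le_add le_rfl (le_of_eq ?_)
  by_cases hst : s = t / D.len
  · simp only [hst, true_and, if_true, mul_ite, mul_zero, explore, mul_sum]
    rw [← sum_filter]
    have : univ.filter (fun a : Fin K => a ≠ 0) = univ.erase 0 := by ext; simp
    rw [this]
    exact sum_congr rfl fun a _ => by ring
  · simp [hst]

/-- The expected number of plays of arms other than `0` in round `t`, under the mixture. -/
def exploreExp (t : ℕ) : ℝ := D.nullExp A t fun h => D.weight t h * D.explore A t h

theorem exploreExp_nonneg (hK : 3 ≤ K) (t : ℕ) : 0 ≤ D.exploreExp A t := by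
  rw [← D.nullExp_zero A t]
  exact D.nullExp_mono A fun h => mul_nonneg (D.weight_nonneg hK t h) (D.explore_nonneg A t h)

theorem exploreExp_le_one (hK : 3 ≤ K) (t : ℕ) : D.exploreExp A t ≤ 1 := by
  rw [← D.nullExp_weight A hK t]
  exact D.nullExp_mono A fun h =>
    mul_le_of_le_one_right (D.weight_nonneg hK t h) (D.explore_le_one A t h)

theorem nullExp_potential_le (hK : 3 ≤ K) (t : ℕ) {s : ℕ} (hs : s < D.blocks) :
    D.nullExp A t (fun h => D.potential t h s) ≤
      ∑ u ∈ range t, if s = u / D.len then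
        2 * D.drift / ((K : ℝ) - 1) * D.exploreExp A u else 0 := by
  induction t with
  | zero =>
    have : D.potential 0 (K := K) Fin.elim0 s = 0 := by
      rw [potential, excess_eq_zero (ℓ := D.lik 0 Fin.elim0 s) (fun j => rfl), mul_zero]
    simp [nullExp, this]
  | succ t ih =>
    rw [sum_range_succ, nullExp]
    refine (D.nullExp_mono A fun h => D.nullStep_potential_le A hK t h hs).trans ?_
    rw [nullExp_add]
    refine add_le_add ih (le_of_eq ?_)
    by_cases hst : s = t / D.len
    · simp only [if_pos hst, nullExp_const_mul, exploreExp]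
    · simp only [if_neg hst, nullExp_zero]

end Weights

/-! ### Averages over the hidden arms. -/

section Averages

/-- The sequences of improved arms, one for each block. -/
def choices (K : ℕ) [NeZero K] : Finset (Fin D.blocks → Fin K) :=
  Fintype.piFinset fun _ => univ.erase 0

/-- The extension of a sequence of arms beyond the last block. -/
def extend (i : Fin D.blocks → Fin K) (s : ℕ) : Fin K :=
  i ⟨min s (D.blocks - 1), by have := D.one_le_blocks; omega⟩

theorem extend_ne_zero {i : Fin D.blocks → Fin K} (hi : i ∈ D.choices K) (s : ℕ) :
    D.extend i s ≠ 0 := by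
  have := Fintype.mem_piFinset.1 hi ⟨min s (D.blocks - 1), by have := D.one_le_blocks; omega⟩
  exact ne_of_mem_erase this

theorem extend_coe (i : Fin D.blocks → Fin K) (s : Fin D.blocks) : D.extend i s = i s := by
  rw [extend]
  congr 1
  ext
  have := s.2
  simp
  omega

theorem sum_choices_prod (f : ℕ → Fin K → ℝ) :
    ∑ i ∈ D.choices K, ∏ s ∈ range D.blocks, f s (D.extend i s) =
      ∏ s ∈ range D.blocks, ∑ j ∈ univ.erase 0, f s j := by
  simp only [prod_range, extend_coe]
  exact (prod_univ_sum (fun _ => univ.erase 0) fun (s : Fin D.blocks) j => f s j).symm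

/-- The likelihood ratio of the environment given by `i`. -/
def density (t : ℕ) (h : Fin t → Obs K) (i : Fin D.blocks → Fin K) : ℝ :=
  ∏ s ∈ range D.blocks, D.lik t h s (D.extend i s)

theorem sum_density (hK : 3 ≤ K) (t : ℕ) (h : Fin t → Obs K) :
    ∑ i ∈ D.choices K, D.density t h i = ((K : ℝ) - 1) ^ D.blocks * D.weight t h := by
  have hK' : (3 : ℝ) ≤ K := by exact_mod_cast hK
  simp only [density]
  rw [D.sum_choices_prod, weight]
  have h2 : ((K : ℝ) - 1) ^ D.blocks = ∏ _s ∈ range D.blocks, ((K : ℝ) - 1) := by simp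
  rw [h2, ← prod_mul_distrib]
  refine prod_congr rfl fun s _ => ?_
  rw [mass, mul_div_cancel₀ _ (by linarith : (K : ℝ) - 1 ≠ 0)]

/-- Up to normalisation, this is the posterior probability that `a` is the hidden arm of block `s`;
the other blocks are summed out independently. -/
theorem sum_density_eq (hK : 3 ≤ K) (t : ℕ) (h : Fin t → Obs K) {s : ℕ} (hs : s < D.blocks)
    {a : Fin K} (ha : a ≠ 0) :
    ∑ i ∈ D.choices K, (if a = D.extend i s then D.density t h i else 0) =
      ((K : ℝ) - 1) ^ D.blocks *
        (D.lik t h s a / ((K : ℝ) - 1) * D.weightExcept t h s) := by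
  have hK' : (3 : ℝ) ≤ K := by exact_mod_cast hK
  have h1 : ∀ i ∈ D.choices K, (if a = D.extend i s then D.density t h i else 0) =
      ∏ u ∈ range D.blocks, D.lik t h u (D.extend i u) *
        if u = s then (if a = D.extend i u then 1 else 0) else 1 := by
    intro i _
    rw [prod_mul_distrib, prod_ite_eq', if_pos (mem_range.2 hs), density]
    split_ifs <;> simp
  rw [sum_congr rfl h1, D.sum_choices_prod fun u j => D.lik t h u j *
    if u = s then (if a = j then 1 else 0) else 1]
  have h2 : ((K : ℝ) - 1) ^ D.blocks = ∏ _s ∈ range D.blocks, ((K : ℝ) - 1) := by simp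
  rw [h2, weightExcept, ← mul_prod_erase _ _ (mem_range.2 hs),
    ← mul_prod_erase (range D.blocks) (fun _ => (K : ℝ) - 1) (mem_range.2 hs),
    mul_mul_mul_comm, ← prod_mul_distrib]
  congr 1
  · have : a ∈ univ.erase (0 : Fin K) := by simp [ha]
    simp only [if_true, mul_ite, mul_one, mul_zero]
    rw [sum_ite_eq, if_pos this, mul_div_cancel₀ _ (by linarith : (K : ℝ) - 1 ≠ 0)]
  · refine prod_congr rfl fun u hu => ?_
    simp only [if_neg (ne_of_mem_erase hu), mul_one]
    rw [mass, mul_div_cancel₀ _ (by linarith : (K : ℝ) - 1 ≠ 0)]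

variable (t : ℕ) (h : Fin t → Obs K)

/-- The mean loss of the arm `a` in round `t`, given the past, in the environment given by `i`. -/
def roundMean (i : Fin D.blocks → Fin K) (a : Fin K) : ℝ :=
  D.mean (improved (D.extend i) (D.switchCount t h)) a

theorem sum_roundMean_zero (hK : 3 ≤ K) :
    ∑ i ∈ D.choices K, D.roundMean t h i 0 * D.density t h i =
      ((K : ℝ) - 1) ^ D.blocks * ((1 / 2 - 7 / 8 * D.gap) * D.weight t h) := by
  simp only [roundMean, mean, if_true]
  rw [← mul_sum, sum_density D hK]
  ring

/-- The posterior mean of `a` in an active round is `1/2` minus `gap` times a posterior probability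
of at most `3/4`; in an idle round it is `1/2`. -/
theorem le_sum_roundMean (hK : 3 ≤ K) {a : Fin K} (ha : a ≠ 0) :
    ((K : ℝ) - 1) ^ D.blocks * ((1 / 2 - 3 / 4 * D.gap) * D.weight t h) ≤
      ∑ i ∈ D.choices K, D.roundMean t h i a * D.density t h i := by
  classical
  have hK' : (3 : ℝ) ≤ K := by exact_mod_cast hK
  have hg := D.gap_pos
  have hW := D.weight_nonneg hK t h
  have hP : (0 : ℝ) ≤ ((K : ℝ) - 1) ^ D.blocks := pow_nonneg (by linarith) _
  by_cases hA : D.Active t h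
  · have h1 : ∀ i ∈ D.choices K, D.roundMean t h i a * D.density t h i =
        1 / 2 * D.density t h i -
          D.gap * (if a = D.extend i (t / D.len) then D.density t h i else 0) := by
      intro i _
      rw [roundMean, improved_switchCount, if_pos hA, mean, if_neg ha]
      split_ifs <;> ring
    rw [sum_congr rfl h1, sum_sub_distrib, ← mul_sum, ← mul_sum, D.sum_density hK,
      D.sum_density_eq hK t h hA.1 ha]
    have h2 := le_mass_of_excess_le hK (D.lik_pos _ _) hA.2.2 ha
    have h3 := mul_le_mul_of_nonneg_right h2 (D.weightExcept_nonneg hK t h (t / D.len))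
    rw [mul_assoc, D.mass_mul_weightExcept t h hA.1] at h3
    have h4 := mul_le_mul_of_nonneg_left h3 (mul_nonneg hg.le hP)
    linarith
  · have h1 : ∀ i ∈ D.choices K, D.roundMean t h i a * D.density t h i =
        1 / 2 * D.density t h i := by
      intro i _
      rw [roundMean, improved_switchCount, if_neg hA, mean, if_neg ha, if_neg ha]
    rw [sum_congr rfl h1, ← mul_sum, D.sum_density hK]
    have := mul_nonneg hP (mul_nonneg hg.le hW)
    linarith

open scoped Classical in
theorem sum_roundMean_extend (hK : 3 ≤ K) :
    ∑ i ∈ D.choices K, D.roundMean t h i (D.extend i (t / D.len)) * D.density t h i =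
      ((K : ℝ) - 1) ^ D.blocks *
        ((1 / 2 - if D.Active t h then D.gap else 0) * D.weight t h) := by
  have h1 : ∀ i ∈ D.choices K,
      D.roundMean t h i (D.extend i (t / D.len)) * D.density t h i =
        (1 / 2 - if D.Active t h then D.gap else 0) * D.density t h i := by
    intro i hi
    have h0 := D.extend_ne_zero hi (t / D.len)
    rw [roundMean, improved_switchCount, mean, if_neg h0]
    split_ifs <;> simp_all
  rw [sum_congr rfl h1, ← mul_sum, D.sum_density hK]
  ring

theorem sum_act_mul_sub (i : Fin D.blocks → Fin K) (c : ℝ) :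
    ∑ a, (A.act t h (D.switchCount t h) a).toReal * (D.roundMean t h i a - c) =
      ∑ a, (A.act t h (D.switchCount t h) a).toReal * D.roundMean t h i a - c := by
  simp only [mul_sub, sum_sub_distrib, ← sum_mul, sum_toReal_eq_one, one_mul]

/-- The law of the next arm does not depend on `i`, so the average over `i` can be taken first.
Exploring then costs `7/8 - 3/4 = 1/8` of the gap more than arm `0`. -/
theorem le_sum_act_roundMean (hK : 3 ≤ K) :
    ((K : ℝ) - 1) ^ D.blocks * ((1 / 2 - 7 / 8 * D.gap) * D.weight t h +
        D.gap / 8 * (D.weight t h * D.explore A t h)) ≤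
      ∑ i ∈ D.choices K, (∑ a, (A.act t h (D.switchCount t h) a).toReal *
        D.roundMean t h i a) * D.density t h i := by
  simp only [sum_mul, mul_assoc]
  rw [sum_comm]
  simp only [← mul_sum]
  rw [← add_sum_erase _ _ (mem_univ (0 : Fin K)), D.sum_roundMean_zero t h hK]
  have h1 : ∑ a ∈ univ.erase (0 : Fin K), (A.act t h (D.switchCount t h) a).toReal *
      (((K : ℝ) - 1) ^ D.blocks * ((1 / 2 - 3 / 4 * D.gap) * D.weight t h)) ≤
      ∑ a ∈ univ.erase (0 : Fin K), (A.act t h (D.switchCount t h) a).toReal *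
        ∑ i ∈ D.choices K, D.roundMean t h i a * D.density t h i :=
    sum_le_sum fun a ha => mul_le_mul_of_nonneg_left
      (D.le_sum_roundMean t h hK (ne_of_mem_erase ha)) ENNReal.toReal_nonneg
  have h2 := sum_toReal_eq_one (A.act t h (D.switchCount t h))
  rw [← add_sum_erase _ _ (mem_univ (0 : Fin K))] at h2
  rw [← sum_mul] at h1
  change _ + D.explore A t h = 1 at h2
  change D.explore A t h * _ ≤ _ at h1
  rw [← eq_sub_iff_add_eq] at h2
  rw [h2]
  linarith

end Averages

end Design

/-! ### Regret against the safe arm and against the hidden arms. -/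

namespace Design

variable {K : ℕ} [NeZero K] (D : Design) (A : Algorithm K)

/-- The expected regret against `p` in the environment given by `i`. -/
def meanRegret (T : ℕ) (i : Fin D.blocks → Fin K) (p : ℕ → Fin K) : ℝ :=
  ∑ t ∈ range T, D.nullExp A t fun h =>
    (∑ a, (A.act t h (D.switchCount t h) a).toReal *
      (D.roundMean t h i a - D.roundMean t h i (p t))) * D.density t h i

theorem le_sum_meanRegret (T : ℕ) (p : (Fin D.blocks → Fin K) → ℕ → Fin K)
    (G : (t : ℕ) → (Fin t → Obs K) → ℝ)
    (hG : ∀ t h, G t h ≤ ∑ i ∈ D.choices K, (∑ a, (A.act t h (D.switchCount t h) a).toReal *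
      D.roundMean t h i a) * D.density t h i -
      ∑ i ∈ D.choices K, D.roundMean t h i (p i t) * D.density t h i) :
    ∑ t ∈ range T, D.nullExp A t (G t) ≤ ∑ i ∈ D.choices K, D.meanRegret A T i (p i) := by
  simp only [meanRegret]
  rw [sum_comm]
  refine sum_le_sum fun t _ => ?_
  rw [← nullExp_sum]
  refine D.nullExp_mono A fun h => (hG t h).trans (le_of_eq ?_)
  rw [← sum_sub_distrib]
  refine sum_congr rfl fun i _ => ?_
  rw [sum_act_mul_sub]
  ring

theorem le_sum_meanRegret_safe (hK : 3 ≤ K) (T : ℕ) :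
    ((K : ℝ) - 1) ^ D.blocks * (D.gap / 8) * ∑ t ∈ range T, D.exploreExp A t ≤
      ∑ i ∈ D.choices K, D.meanRegret A T i fun _ => 0 := by
  refine le_trans (le_of_eq ?_) (D.le_sum_meanRegret A T (fun _ _ => 0)
    (fun t h => ((K : ℝ) - 1) ^ D.blocks * (D.gap / 8) *
      (D.weight t h * D.explore A t h)) fun t h => ?_)
  · simp only [nullExp_const_mul, exploreExp, mul_sum]
  · have := D.le_sum_act_roundMean A t h hK
    rw [D.sum_roundMean_zero t h hK]
    linarith

open scoped Classical in
/-- The probability that no arm is improved in round `t`, under the mixture. -/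
def inactiveExp (t : ℕ) : ℝ :=
  D.nullExp A t fun h => if D.Active t h then 0 else D.weight t h

/-- The algorithm loses at least `1/2 - 7/8 * gap` on average. The comparator loses `1/2 - gap` in
an active round, and `1/2` in an idle one, where its deficit of at most `7/8 * gap` is covered by
`gap / 8 - 2 * gap`. -/
theorem le_sum_meanRegret_extend (hK : 3 ≤ K) (T : ℕ) :
    ((K : ℝ) - 1) ^ D.blocks *
        (D.gap / 8 * T - 2 * D.gap * ∑ t ∈ range T, D.inactiveExp A t) ≤
      ∑ i ∈ D.choices K, D.meanRegret A T i fun t => D.extend i (t / D.len) := by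
  classical
  have hK' : (3 : ℝ) ≤ K := by exact_mod_cast hK
  have hg := D.gap_pos
  have hP : (0 : ℝ) ≤ ((K : ℝ) - 1) ^ D.blocks := pow_nonneg (by linarith) _
  refine le_trans (le_of_eq ?_) (D.le_sum_meanRegret A T (fun i t => D.extend i (t / D.len))
    (fun t h => ((K : ℝ) - 1) ^ D.blocks * (D.gap / 8) * D.weight t h +
      (-(((K : ℝ) - 1) ^ D.blocks * (2 * D.gap))) *
        if D.Active t h then 0 else D.weight t h) fun t h => ?_)
  · simp only [nullExp_add, nullExp_const_mul]
    rw [sum_add_distrib, ← mul_sum, ← mul_sum]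
    have h1 : ∑ t ∈ range T, D.nullExp A t (fun h => D.weight t h) = T := by
      rw [sum_congr rfl fun t _ => D.nullExp_weight A hK t]
      simp
    rw [h1]
    simp only [inactiveExp]
    ring
  · have h1 := D.le_sum_act_roundMean A t h hK
    have h2 : 0 ≤ ((K : ℝ) - 1) ^ D.blocks * (D.gap * (D.weight t h * D.explore A t h)) :=
      mul_nonneg hP (mul_nonneg hg.le
        (mul_nonneg (D.weight_nonneg hK t h) (D.explore_nonneg A t h)))
    have h3 : 0 ≤ ((K : ℝ) - 1) ^ D.blocks * (D.gap * D.weight t h) :=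
      mul_nonneg hP (mul_nonneg hg.le (D.weight_nonneg hK t h))
    rw [D.sum_roundMean_extend t h hK]
    split_ifs <;> linarith

theorem card_filter_div_eq_le (T s : ℕ) :
    ((range T).filter fun t => t / D.len = s).card ≤ D.len := by
  have hB : 0 < D.len := by have := D.two_le_len; omega
  calc _ ≤ (Ico (s * D.len) ((s + 1) * D.len)).card := by
        refine card_le_card fun t ht => ?_
        rw [mem_filter] at ht
        rw [mem_Ico, ← Nat.le_div_iff_mul_le hB, ← Nat.div_lt_iff_lt_mul hB]
        omega
    _ = D.len := by rw [Nat.card_Ico, ← Nat.sub_mul]; simp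

/-- One closing round per block, and at most `blocks` rounds left over after the last block. -/
theorem card_exceptional_le {T : ℕ} (hT : T ≤ D.blocks * D.len + D.blocks) :
    ((range T).filter fun t => ¬ (t / D.len < D.blocks ∧ (t + 1) % D.len ≠ 0)).card ≤
      2 * D.blocks := by
  classical
  have hB : 0 < D.len := by have := D.two_le_len; omega
  have hsub : (range T).filter (fun t => ¬ (t / D.len < D.blocks ∧ (t + 1) % D.len ≠ 0)) ⊆
      Ico (D.blocks * D.len) (D.blocks * D.len + D.blocks) ∪
        (range D.blocks).image fun s => s * D.len + (D.len - 1) := by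
    intro t ht
    rw [mem_filter, mem_range, not_and_or, not_lt, not_not, Nat.le_div_iff_mul_le hB] at ht
    rw [mem_union, mem_Ico, mem_image]
    by_cases h : D.blocks * D.len ≤ t
    · exact Or.inl ⟨h, by omega⟩
    · refine Or.inr ⟨t / D.len, mem_range.2 ((Nat.div_lt_iff_lt_mul hB).2 (by omega)), ?_⟩
      obtain ⟨q, hq⟩ := Nat.dvd_of_mod_eq_zero (ht.2.resolve_left h)
      have hq0 : 1 ≤ q := by
        rcases Nat.eq_zero_or_pos q with h0 | h0
        · rw [h0] at hq; omega
        · exact h0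
      obtain ⟨r, rfl⟩ : ∃ r, q = r + 1 := ⟨q - 1, by omega⟩
      have h1 : t = r * D.len + (D.len - 1) := by
        have : D.len * (r + 1) = r * D.len + D.len := by ring
        omega
      have h2 : t / D.len = r := by
        rw [h1, mul_comm, Nat.mul_add_div hB, Nat.div_eq_of_lt (by omega), add_zero]
      rw [h2]
      exact h1.symm
  refine (card_le_card hsub).trans ((card_union_le _ _).trans ?_)
  have := card_image_le (s := range D.blocks) (f := fun s => s * D.len + (D.len - 1))
  rw [card_range] at this
  rw [Nat.card_Ico]
  omega

-- Apart from the exceptional rounds, being idle means an excess above `1/8`, and Markov's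
-- inequality applies. The constant `48` is `8` from this threshold, `3` from the bound on the mass
-- when passing from `weight` to `weightExcept`, and `2` from `nullStep_potential_le`.
open scoped Classical in
theorem inactiveExp_le (hK : 3 ≤ K) (T : ℕ) {t : ℕ} (ht : t < T) :
    D.inactiveExp A t ≤ (if ¬ (t / D.len < D.blocks ∧ (t + 1) % D.len ≠ 0) then 1 else 0) +
      ∑ u ∈ range T, if t / D.len = u / D.len then
        48 * D.drift / ((K : ℝ) - 1) * D.exploreExp A u else 0 := by
  have hK' : (3 : ℝ) ≤ K := by exact_mod_cast hK
  have hd := D.drift_nonneg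
  have hk : (0 : ℝ) < (K : ℝ) - 1 := by linarith
  have hterm : ∀ u, 0 ≤ if t / D.len = u / D.len then
      48 * D.drift / ((K : ℝ) - 1) * D.exploreExp A u else 0 := by
    intro u
    have := D.exploreExp_nonneg A hK u
    split_ifs <;> positivity
  by_cases hex : t / D.len < D.blocks ∧ (t + 1) % D.len ≠ 0
  · rw [if_neg (not_not.2 hex), zero_add]
    have h1 : D.inactiveExp A t ≤ 24 * D.nullExp A t fun h => D.potential t h (t / D.len) := by
      rw [inactiveExp, ← nullExp_const_mul]
      refine D.nullExp_mono A fun h => ?_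
      have hW := D.weightExcept_nonneg hK t h (t / D.len)
      have he := excess_nonneg hK (D.lik_pos h (t / D.len))
      rw [potential]
      by_cases hA : D.Active t h
      · rw [if_pos hA]
        positivity
      · rw [if_neg hA, ← D.mass_mul_weightExcept t h hex.1]
        have hlt : 1 / 8 < excess (D.lik t h (t / D.len)) := by
          by_contra! hle
          exact hA ⟨hex.1, hex.2, hle⟩
        have hm := D.mass_lik_le hK h (t / D.len)
        calc _ ≤ 3 * D.weightExcept t h (t / D.len) := mul_le_mul_of_nonneg_right hm hW
          _ ≤ (24 * excess (D.lik t h (t / D.len))) * D.weightExcept t h (t / D.len) :=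
              mul_le_mul_of_nonneg_right (by linarith) hW
          _ = _ := by ring
    have h2 := D.nullExp_potential_le A hK t hex.1
    refine h1.trans ((mul_le_mul_of_nonneg_left h2 (by norm_num)).trans ?_)
    rw [mul_sum]
    refine le_trans (le_of_eq (sum_congr rfl fun u _ => ?_))
      (sum_le_sum_of_subset_of_nonneg (range_subset_range.2 ht.le) fun u _ _ => hterm u)
    split_ifs <;> ring
  · rw [if_pos hex]
    refine le_add_of_le_of_nonneg ?_ (sum_nonneg fun u _ => hterm u)
    rw [inactiveExp, ← D.nullExp_weight A hK t]
    refine D.nullExp_mono A fun h => ?_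
    have := D.weight_nonneg hK t h
    split_ifs <;> linarith

theorem sum_inactiveExp_le (hK : 3 ≤ K) {T : ℕ} (hT : T ≤ D.blocks * D.len + D.blocks) :
    ∑ t ∈ range T, D.inactiveExp A t ≤ 2 * D.blocks +
      48 * D.drift / ((K : ℝ) - 1) * D.len * ∑ u ∈ range T, D.exploreExp A u := by
  classical
  have hK' : (3 : ℝ) ≤ K := by exact_mod_cast hK
  have hk : (0 : ℝ) < (K : ℝ) - 1 := by linarith
  have hd := D.drift_nonneg
  refine (sum_le_sum fun t ht => D.inactiveExp_le A hK T (mem_range.1 ht)).trans ?_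
  rw [sum_add_distrib]
  refine add_le_add ?_ ?_
  · rw [sum_boole]
    exact_mod_cast D.card_exceptional_le hT
  · rw [sum_comm, mul_sum]
    refine sum_le_sum fun u _ => ?_
    rw [← sum_filter, sum_const, nsmul_eq_mul]
    have h1 : (((range T).filter fun t => t / D.len = u / D.len).card : ℝ) ≤ D.len := by
      exact_mod_cast D.card_filter_div_eq_le T (u / D.len)
    have h2 := D.exploreExp_nonneg A hK u
    calc _ ≤ (D.len : ℝ) * (48 * D.drift / ((K : ℝ) - 1) * D.exploreExp A u) :=
          mul_le_mul_of_nonneg_right h1 (by positivity)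
      _ = _ := by ring

/-- `extend` repeats the last arm past the last block, so changes occur only at the `blocks - 1`
inner boundaries. -/
theorem extend_mem_switchPolicies (i : Fin D.blocks → Fin K) (T : ℕ) {S : ℕ}
    (hS : D.blocks - 1 ≤ S) :
    (fun t : Fin T => D.extend i (t / D.len)) ∈ switchPolicies K T S := by
  classical
  have hB : 0 < D.len := by have := D.two_le_len; omega
  refine le_trans ?_ hS
  rw [← card_range (D.blocks - 1)]
  have key : ∀ t : Fin T, (∃ h : (t : ℕ) + 1 < T, D.extend i (t / D.len) ≠
      D.extend i ((⟨(t : ℕ) + 1, h⟩ : Fin T) / D.len : ℕ)) →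
      (t : ℕ) + 1 = (t / D.len + 1) * D.len ∧ t / D.len < D.blocks - 1 := by
    rintro t ⟨h, hne⟩
    have h1 : ((t : ℕ) + 1) / D.len ≠ t / D.len := fun h => hne (by simp [h])
    rw [Nat.succ_div] at h1
    have hdvd : D.len ∣ (t : ℕ) + 1 := by
      by_contra h'
      exact h1 (by rw [if_neg h', add_zero])
    have hdiv : ((t : ℕ) + 1) / D.len = t / D.len + 1 := by rw [Nat.succ_div, if_pos hdvd]
    refine ⟨by rw [← hdiv, Nat.div_mul_cancel hdvd], ?_⟩
    by_contra! hle
    refine hne ?_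
    simp only [hdiv, extend]
    congr 2
    omega
  refine card_le_card_of_injOn (fun t : Fin T => t / D.len) ?_ ?_
  · intro t ht
    exact mem_coe.2 (mem_range.2 (key t (mem_filter.1 (mem_coe.1 ht)).2).2)
  · intro t ht u hu htu
    have h1 := (key t (mem_filter.1 (mem_coe.1 ht)).2).1
    have h2 := (key u (mem_filter.1 (mem_coe.1 hu)).2).1
    simp only at htu
    rw [htu] at h1
    exact Fin.ext (by omega)

end Design

/-! ### The trade-off between the two comparators. -/

theorem le_switchRegret {K : ℕ} (A : Algorithm K) (E : Environment K) {T S : ℕ}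
    {π : Fin T → Fin K} (hπ : π ∈ switchPolicies K T S) :
    (expectation (play A E T) fun ω =>
      ∑ t : Fin T, (((ω t).losses (ω t).arm : ℝ) - ((ω t).losses (π t) : ℝ))) ≤
      switchRegret A E T S :=
  le_ciSup (f := fun π : switchPolicies K T S => expectation (play A E T) fun ω =>
    ∑ t : Fin T, (((ω t).losses (ω t).arm : ℝ) - ((ω t).losses (π.1 t) : ℝ)))
    (Set.finite_range _).bddAbove ⟨π, hπ⟩

namespace Design

variable {K : ℕ} [NeZero K] (D : Design) (A : Algorithm K)

theorem meanRegret_le_switchRegret {T S : ℕ} {i : Fin D.blocks → Fin K}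
    (hi : ∀ s, D.extend i s ≠ 0) {p : ℕ → Fin K}
    (hp : (fun t : Fin T => p t) ∈ switchPolicies K T S) :
    D.meanRegret A T i p ≤ switchRegret A (D.env (D.extend i) hi) T S := by
  refine le_trans (le_of_eq ?_) (le_switchRegret A _ hp)
  exact (D.expectation_play_env_regret A _ hi T p).symm

theorem card_choices : ((D.choices K).card : ℝ) = ((K : ℝ) - 1) ^ D.blocks := by
  rw [choices, Fintype.card_piFinset, prod_const, card_univ, Fintype.card_fin, Nat.cast_pow,
    card_erase_zero]

/-- If the regret against constant arms is at most `R` in all environments, then one of the hard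
environments has a large regret against a sequence that switches at the ends of the blocks. -/
theorem exists_le_switchRegret (hK : 3 ≤ K) {T S : ℕ} {R : ℝ}
    (hT : T ≤ D.blocks * D.len + D.blocks) (hS : 2 * D.blocks - 1 ≤ S)
    (hR : ∀ E : Environment K, switchRegret A E T 1 ≤ R) :
    ∃ (E : Environment K) (N : ℝ), E.AtMostSwitches S ∧ N ≤ T ∧ D.gap * N ≤ 8 * R ∧
      D.gap / 8 * T - 2 * D.gap * (2 * D.blocks + 192 * D.gap ^ 2 / ((K : ℝ) - 1) * D.len * N) ≤
        switchRegret A E T S := by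
  have hK' : (3 : ℝ) ≤ K := by exact_mod_cast hK
  have hk : (0 : ℝ) < (K : ℝ) - 1 := by linarith
  have hP : (0 : ℝ) < ((K : ℝ) - 1) ^ D.blocks := pow_pos hk _
  have hg := D.gap_pos
  have hcard := D.card_choices (K := K)
  set N := ∑ t ∈ range T, D.exploreExp A t with hN
  have hN0 : 0 ≤ N := sum_nonneg fun t _ => D.exploreExp_nonneg A hK t
  have hNT : N ≤ T := by
    have := sum_le_sum (s := range T) fun t _ => D.exploreExp_le_one A hK t
    simpa using this
  have hNR : D.gap * N ≤ 8 * R := by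
    have h1 := D.le_sum_meanRegret_safe A hK T
    have h2 : ∑ i ∈ D.choices K, D.meanRegret A T i (fun _ => 0) ≤
        ∑ _i ∈ D.choices K, R := by
      refine sum_le_sum fun i hi => ?_
      refine (D.meanRegret_le_switchRegret A (D.extend_ne_zero hi) ?_).trans (hR _)
      simp [switchPolicies]
    rw [sum_const, nsmul_eq_mul, hcard] at h2
    have h3 := h1.trans h2
    rw [mul_assoc] at h3
    have := le_of_mul_le_mul_left h3 hP
    linarith
  have h1 := D.le_sum_meanRegret_extend A hK T
  rw [← hcard, ← nsmul_eq_mul, ← sum_const] at h1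
  have hne : (D.choices K).Nonempty := by
    rw [← card_pos, ← Nat.cast_pos (α := ℝ), hcard]
    exact hP
  -- Some environment does at least as well as the average. `N` is computed under the mixture, so it
  -- is the same for every `i`.
  obtain ⟨i, hi, h2⟩ := exists_le_of_sum_le hne h1
  refine ⟨D.env (D.extend i) (D.extend_ne_zero hi), N, fun t h =>
    (D.env_atMostSwitches _ _ t h).trans hS, hNT, hNR, le_trans ?_ (h2.trans
    (D.meanRegret_le_switchRegret A (D.extend_ne_zero hi)
      (D.extend_mem_switchPolicies i T (by omega))))⟩
  have h3 := D.sum_inactiveExp_le A hK hT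
  have h4 : 48 * D.drift / ((K : ℝ) - 1) * D.len * N ≤
      192 * D.gap ^ 2 / ((K : ℝ) - 1) * D.len * N := by
    have h5 := D.drift_le
    exact mul_le_mul_of_nonneg_right (mul_le_mul_of_nonneg_right
      (div_le_div_of_nonneg_right (by linarith) hk.le) (Nat.cast_nonneg _)) hN0
  have h5 : 2 * D.gap * ∑ t ∈ range T, D.inactiveExp A t ≤
      2 * D.gap * (2 * D.blocks + 192 * D.gap ^ 2 / ((K : ℝ) - 1) * D.len * N) :=
    mul_le_mul_of_nonneg_left (by linarith) (by linarith)
  linarith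

/-- With few blocks, and a gap too small to find the improved arms, the regret is linear in the
gap and in the number of rounds. -/
theorem exists_gap_mul_le_switchRegret (hK : 3 ≤ K) {T S : ℕ} {R : ℝ}
    (hT : T ≤ D.blocks * D.len + D.blocks) (hT' : D.blocks * D.len ≤ T)
    (hn : 128 * D.blocks ≤ T) (hS : 2 * D.blocks - 1 ≤ S)
    (hR : ∀ E : Environment K, switchRegret A E T 1 ≤ R)
    (hgap : 98304 * D.gap * R ≤ ((K : ℝ) - 1) * D.blocks ∨
      12288 * D.gap ^ 2 * T ≤ ((K : ℝ) - 1) * D.blocks) :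
    ∃ E : Environment K, E.AtMostSwitches S ∧ D.gap * T / 16 ≤ switchRegret A E T S := by
  obtain ⟨E, N, hES, hNT, hNR, hE⟩ := D.exists_le_switchRegret A hK hT hS hR
  refine ⟨E, hES, le_trans ?_ hE⟩
  have hK' : (3 : ℝ) ≤ K := by exact_mod_cast hK
  have hk : (0 : ℝ) < (K : ℝ) - 1 := by linarith
  have hg := D.gap_pos
  have hn' : 128 * (D.blocks : ℝ) ≤ T := by exact_mod_cast hn
  have hT'' : (D.blocks : ℝ) * D.len ≤ T := by exact_mod_cast hT'
  -- The alternatives use `gap * N ≤ 8 * R` (hence `98304 = 8 * 12288`) and `N ≤ T`. As `12288 = 64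
  -- * 192`, the information term is at most `T / 64`, and so is `2 * blocks`; half of `gap / 8 * T`
  -- survives.
  have hN : 12288 * D.gap ^ 2 * N ≤ ((K : ℝ) - 1) * D.blocks := by
    rcases hgap with h | h
    · nlinarith [mul_le_mul_of_nonneg_left hNR hg.le]
    · refine le_trans ?_ h
      gcongr
  have h1 : 192 * D.gap ^ 2 / ((K : ℝ) - 1) * D.len * N ≤ T / 64 := by
    have h2 : 192 * D.gap ^ 2 / ((K : ℝ) - 1) * D.len * N =
        (192 * D.gap ^ 2 * N) * D.len / ((K : ℝ) - 1) := by ring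
    rw [h2, div_le_iff₀ hk]
    have h3 : (0 : ℝ) ≤ D.len := Nat.cast_nonneg _
    have h4 := mul_le_mul_of_nonneg_right hN h3
    have h5 := mul_le_mul_of_nonneg_left hT'' hk.le
    linarith
  have h2 : D.gap * (2 * D.blocks + 192 * D.gap ^ 2 / ((K : ℝ) - 1) * D.len * N) ≤
      D.gap * (T / 64 + T / 64) := mul_le_mul_of_nonneg_left (by linarith) hg.le
  linarith

end Design

end SwitchBandit

end

/-! ### Choice of the gap and of the number of blocks. -/

theorem mainTheorem4 (a c : ℝ) (ha : 0 < a) (hc : 0 < c) :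
    ∃ c' : ℝ, 0 < c' ∧
      ∀ K : ℕ, 3 ≤ K → ∃ T₀ : ℕ, ∀ T : ℕ, T₀ ≤ T → ∀ C : ℝ, 0 < C →
        ∀ A : SwitchBandit.Algorithm K,
          (∀ E : SwitchBandit.Environment K,
            SwitchBandit.switchRegret A E T 1 ≤ a * (C * Real.sqrt ((K : ℝ) * (T : ℝ)))) →
          ∀ S : ℕ, c * C ^ 2 ≤ (S : ℝ) →
            ∃ E : SwitchBandit.Environment K, E.AtMostSwitches S ∧
              c' * min ((S : ℝ) / C * Real.sqrt ((K : ℝ) * (T : ℝ))) (T : ℝ) ≤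
                SwitchBandit.switchRegret A E T S := by
  -- Here `32768 = 16 * 2048`, for the fixed gap `1 / 2048` of the second case, and `6291456 = 16 *
  -- 4 * 98304`, the `4` coming from `K - 1 ≥ K / 2` and `n ≥ S / 2`.
  refine ⟨min (1 / 32768) (1 / (6291456 * a)), by positivity, fun K hK => ⟨128, ?_⟩⟩
  intro T hT C hC A hR S hS
  have : NeZero K := ⟨by omega⟩
  have hK' : (3 : ℝ) ≤ K := by exact_mod_cast hK
  have hT' : (128 : ℝ) ≤ T := by exact_mod_cast hT
  set c' := min (1 / 32768 : ℝ) (1 / (6291456 * a))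
  have hc'0 : 0 ≤ c' := by positivity
  have hc'1 : c' ≤ 1 / 32768 := min_le_left _ _
  have hc'2 : c' ≤ 1 / (6291456 * a) := min_le_right _ _
  have hS1 : 1 ≤ S := by
    have : (0 : ℝ) < S := lt_of_lt_of_le (by positivity) hS
    exact_mod_cast this
  set q := Real.sqrt ((K : ℝ) * T) with hq
  have hKT : (0 : ℝ) < (K : ℝ) * T := by positivity
  have hq0 : 0 < q := Real.sqrt_pos.2 hKT
  have hqq : q * q = (K : ℝ) * T := Real.mul_self_sqrt hKT.le
  have hlin : c' * min ((S : ℝ) / C * q) T ≤ T / 32768 := by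
    calc c' * min ((S : ℝ) / C * q) T ≤ 1 / 32768 * T :=
          mul_le_mul hc'1 (min_le_right _ _) (by positivity) (by norm_num)
      _ = T / 32768 := by ring
  have hblocks : ∀ n : ℕ, 1 ≤ n → 128 * n ≤ T →
      2 ≤ T / n ∧ n * (T / n) ≤ T ∧ T ≤ n * (T / n) + n := by
    intro n hn hnT
    refine ⟨?_, Nat.mul_div_le T n, ?_⟩
    · rw [Nat.le_div_iff_mul_le (by omega)]
      omega
    · have h1 := Nat.div_add_mod T n
      have h2 := Nat.mod_lt T (by omega : 0 < n)
      omega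
  -- `S` switches pay for `(S + 1) / 2` blocks, each using two switches except the last, which uses
  -- one. More than `T / 128` blocks would be too short.
  by_cases hcase : (S + 1) / 2 ≤ T / 128
  · set n := (S + 1) / 2 with hn
    obtain ⟨hB, hle, hge⟩ := hblocks n (by omega) (by omega)
    have hnS : (S : ℝ) / 2 ≤ n := by
      have : S ≤ 2 * n := by omega
      have : (S : ℝ) ≤ 2 * n := by exact_mod_cast this
      linarith
    have hS0 : (0 : ℝ) < S := by exact_mod_cast hS1
    -- The largest gap allowed by the first alternative of `hgap` for `R = a * (C * q)`. The cap `1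
    -- / 8` yields the linear term of the minimum.
    set r := ((K : ℝ) - 1) * n / (98304 * (a * (C * q))) with hr
    have hr0 : 0 < r := div_pos (mul_pos (by linarith) (by linarith)) (by positivity)
    obtain ⟨E, hES, hE⟩ := SwitchBandit.Design.exists_gap_mul_le_switchRegret (S := S)
      ⟨min (1 / 8) r, T / n, n, by positivity, min_le_left _ _, hB, by omega⟩ A hK hge hle
      (by simp only; omega) (by simp only; omega) hR (Or.inl (by
        simp only
        have h1 : min (1 / 8) r * (98304 * (a * (C * q))) ≤ r * (98304 * (a * (C * q))) :=
          mul_le_mul_of_nonneg_right (min_le_right _ _) (by positivity)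
        rw [hr, div_mul_cancel₀ _ (by positivity)] at h1
        linarith))
    refine ⟨E, hES, le_trans ?_ hE⟩
    simp only
    rcases min_choice (1 / 8) r with h | h
    · rw [h]
      linarith
    · rw [h]
      calc c' * min ((S : ℝ) / C * q) T ≤ 1 / (6291456 * a) * (S / C * q) :=
            mul_le_mul hc'2 (min_le_left _ _) (by positivity) (by positivity)
        _ = (K / 2) * (S / 2) / (98304 * (a * (C * q))) * T / 16 := by
            field_simp
            rw [sq, hqq]
            ring
        _ ≤ r * T / 16 := by
            have h1 : (K : ℝ) / 2 * (S / 2) ≤ (K - 1) * n :=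
              mul_le_mul (by linarith) hnS (by positivity) (by linarith)
            rw [hr]
            gcongr
  -- With this many switches linear regret is reached at a constant gap: `T ≤ 256 * n` and `12288 *
  -- 256 ≤ 2 * 2048 ^ 2` give the second alternative of `hgap`.
  · set n := T / 128 with hn
    obtain ⟨hB, hle, hge⟩ := hblocks n (by omega) (by omega)
    obtain ⟨E, hES, hE⟩ := SwitchBandit.Design.exists_gap_mul_le_switchRegret (S := S)
      ⟨1 / 2048, T / n, n, by norm_num, by norm_num, hB, by omega⟩ A hK hge hle
      (by simp only; omega) (by simp only; omega) hR (Or.inr (by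
        simp only
        have h1 : T ≤ 256 * n := by omega
        have h2 : (T : ℝ) ≤ 256 * n := by exact_mod_cast h1
        have h3 : 2 * (n : ℝ) ≤ (K - 1) * n :=
          mul_le_mul_of_nonneg_right (by linarith) (Nat.cast_nonneg _)
        linarith))
    refine ⟨E, hES, le_trans ?_ hE⟩
    simp only
    linarith
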